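/- Let $0<q<1$ be such that $\frac{\log(1-q)}{\log q}\in\mathbb{Z}$, and let $\mathbb{R}_{q,+}=\{q^n : n\in\mathbb{Z}\}$. For $g$ on $\mathbb{R}_{q,+}$ put $$\int_0^\infty g(t)\,d_qt=(1-q)\sum_{n=-\infty}^{\infty} g(q^n)\,q^n$$ whenever the sum converges absolutely. Write $(a;q)_n=\prod_{k=0}^{n-1}(1-aq^k)$, $(a;q)_\infty=\prod_{k=0}^{\infty}(1-aq^k)$, $[n]_q!=\frac{(q;q)_n}{(1-q)^n}$, $\Gamma_q(x)=\frac{(q;q)_\infty}{(q^x;q)_\infty}(1-q)^{1-x}$, and $$\sin(x;q^2)=\sum_{n=0}^{\infty}(-1)^nq^{n(n-1)}\frac{x^{2n+1}}{[2n+1]_q!},\qquad c_q=\frac{(1+q^{-1})^{1/2}}{\Gamma_{q^2}(1/2)}.$$ Let $L^2_q(\mathbb{R}_{q,+})$ be the space of (real- or complex-valued) functions $f$ on $\mathbb{R}_{q,+}$ with $\int_0^\infty|f(t)|^2d_qt<\infty$, normed by $\|f\|_{q,2}=\left(\int_0^\infty|f(t)|^2\,d_qt\right)^{1/2}$. The $q$-Fourier-sine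 transform of $f$ is $${}_q\mathcal{F}(f)(x)=c_q\int_0^\infty f(t)\sin(xt;q^2)\,d_qt,\qquad x\in\mathbb{R}_{q,+}.$$ 1) For every $f\in L^2_q(\mathbb{R}_{q,+})$, the integral defining ${}_q\mathcal{F}(f)(x)$ converges absolutely for every $x\in\mathbb{R}_{q,+}$, the function ${}_q\mathcal{F}(f)$ lies in $L^2_q(\mathbb{R}_{q,+})$, and $$\|{}_q\mathcal{F}(f)\|_{q,2}=q\,\|f\|_{q,2}.$$ 2) ${}_q\mathcal{F}$ is an isomorphism (a linear homeomorphism) of $L^2_q(\mathbb{R}_{q,+})$ onto itself, and $({}_q\mathcal{F})^{-1}=\frac{1}{q^2}\;{}_q\mathcal{F}$. -/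

import Mathlib

noncomputable section

namespace QFourier

/-- The finite `q`-shifted factorial `(a; q)_n = ∏_{k < n} (1 - a q ^ k)`. -/
def qPoch (a q : ℝ) (n : ℕ) : ℝ := ∏ k ∈ Finset.range n, (1 - a * q ^ k)

/-- The infinite `q`-shifted factorial `(a; q)_∞ = ∏_{k ≥ 0} (1 - a q ^ k)`. -/
def qPochInf (a q : ℝ) : ℝ := ∏' k : ℕ, (1 - a * q ^ k)

/-- Jackson's `q`-Gamma function
`Γ_q(x) = (q; q)_∞ / (q ^ x; q)_∞ * (1 - q) ^ (1 - x)` at a real argument. -/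
def qGamma (q x : ℝ) : ℝ := qPochInf q q / qPochInf (q ^ x) q * (1 - q) ^ (1 - x)

/-- The `q`-factorial `[n]_q! = (q; q)_n / (1 - q) ^ n`. -/
def qFactorial (q : ℝ) (n : ℕ) : ℝ := qPoch q q n / (1 - q) ^ n

/-- The `q`-sine `sin(x; q²) = ∑_{n ≥ 0} (-1) ^ n q ^ (n (n - 1)) x ^ (2 n + 1) / [2 n + 1]_q!`. -/
def qSin (q x : ℝ) : ℝ :=
  ∑' n : ℕ, (-1) ^ n * q ^ (n * (n - 1)) * (x ^ (2 * n + 1) / qFactorial q (2 * n + 1))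

/-- The set `ℝ_{q,+} = {q ^ n : n ∈ ℤ}`. -/
def qHalfLine (q : ℝ) : Set ℝ := Set.range fun n : ℤ => q ^ n

/-- The point `q ^ n` of `ℝ_{q,+}`. -/
def qPt (q : ℝ) (n : ℤ) : qHalfLine q := ⟨q ^ n, n, rfl⟩

section Jackson

variable {q : ℝ} {E : Type*} [NormedAddCommGroup E] [NormedSpace ℝ E]

/-- Absolute convergence of the `q`-Jackson integral of `g` from `0` to `∞`. -/
def QIntegrable (g : qHalfLine q → E) : Prop :=
  Summable fun n : ℤ => ‖q ^ n • g (qPt q n)‖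

/-- The `q`-Jackson integral `∫_0^∞ g(t) d_q t = (1 - q) ∑_{n ∈ ℤ} g(q ^ n) q ^ n`
(meaningful when `QIntegrable g`). -/
def qIntegral (g : qHalfLine q → E) : E :=
  (1 - q) • ∑' n : ℤ, q ^ n • g (qPt q n)

end Jackson

section L2

variable {q : ℝ} {𝕜 : Type*} [RCLike 𝕜]

/-- Membership in `L²_q(ℝ_{q,+})`: the `q`-Jackson integral of `|f|²` converges. -/
def MemL2 (f : qHalfLine q → 𝕜) : Prop := QIntegrable fun t => ‖f t‖ ^ 2

/-- The norm `‖f‖_{q,2} = (∫_0^∞ |f(t)|² d_q t) ^ (1 / 2)`. -/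
def l2Norm (f : qHalfLine q → 𝕜) : ℝ := Real.sqrt (qIntegral fun t => ‖f t‖ ^ 2)

/-- The constant `c_q = (1 + q⁻¹) ^ (1 / 2) / Γ_{q²}(1 / 2)`. -/
def cq (q : ℝ) : ℝ := (1 + q⁻¹) ^ (1 / 2 : ℝ) / qGamma (q ^ 2) (1 / 2)

/-- The `q`-Fourier-sine transform
`_q𝓕(f)(x) = c_q ∫_0^∞ f(t) sin(x t; q²) d_q t`, `x ∈ ℝ_{q,+}`. -/
def qSineTransform (f : qHalfLine q → 𝕜) (x : qHalfLine q) : 𝕜 :=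
  (cq q : 𝕜) * qIntegral fun t => f t * (qSin q ((x : ℝ) * (t : ℝ)) : 𝕜)

end L2

section Space

variable (q : ℝ) [hq : Fact (0 < q ∧ q < 1)] (𝕜 : Type*) [RCLike 𝕜]

variable {q 𝕜} in
theorem memL2_iff (f : qHalfLine q → 𝕜) :
    MemL2 f ↔ Summable fun n : ℤ => q ^ n * ‖f (qPt q n)‖ ^ 2 := by
  have h0 := hq.out.1
  unfold MemL2 QIntegrable
  refine summable_congr fun n => ?_
  rw [Real.norm_of_nonneg (by rw [smul_eq_mul]; positivity), smul_eq_mul]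

variable {q 𝕜} in
theorem memL2_add_and_norm (f g : qHalfLine q → 𝕜) (hf : MemL2 f) (hg : MemL2 g) :
    MemL2 (f + g) ∧ l2Norm (f + g) ≤ l2Norm f + l2Norm g := by
  have h0 := hq.out.1
  have h1 : 0 < 1 - q := by linarith [hq.out.2]
  rw [memL2_iff] at *
  have key : ∀ (a : ℤ → ℝ) n, (Real.sqrt (q ^ n) * a n) ^ (2 : ℝ) = q ^ n * (a n) ^ 2 := by
    intro a n
    rw [Real.rpow_two, mul_pow, Real.sq_sqrt (by positivity)]
  have mink := Real.Lp_add_le_tsum_of_nonneg (p := 2)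
    (f := fun n : ℤ => Real.sqrt (q ^ n) * ‖f (qPt q n)‖)
    (g := fun n : ℤ => Real.sqrt (q ^ n) * ‖g (qPt q n)‖) (by norm_num)
    (fun n => by positivity) (fun n => by positivity)
    (by simpa only [key fun n => ‖f (qPt q n)‖] using hf)
    (by simpa only [key fun n => ‖g (qPt q n)‖] using hg)
  simp only [← mul_add, key fun n => ‖f (qPt q n)‖, key fun n => ‖g (qPt q n)‖,
    key fun n => ‖f (qPt q n)‖ + ‖g (qPt q n)‖, ← Real.sqrt_eq_rpow] at mink
  have hle : ∀ n : ℤ, q ^ n * ‖(f + g) (qPt q n)‖ ^ 2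
      ≤ q ^ n * (‖f (qPt q n)‖ + ‖g (qPt q n)‖) ^ 2 := by
    intro n
    have := norm_add_le (f (qPt q n)) (g (qPt q n))
    rw [Pi.add_apply]
    gcongr
  have hs : Summable fun n : ℤ => q ^ n * ‖(f + g) (qPt q n)‖ ^ 2 :=
    Summable.of_nonneg_of_le (fun n => by positivity) hle mink.1
  refine ⟨hs, ?_⟩
  simp only [l2Norm, qIntegral, smul_eq_mul, Real.sqrt_mul h1.le]
  rw [← mul_add]
  refine mul_le_mul_of_nonneg_left ?_ (Real.sqrt_nonneg _)
  exact (Real.sqrt_le_sqrt (hs.tsum_le_tsum hle mink.1)).trans mink.2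

variable {q 𝕜} in
theorem memL2_smul_and_norm (c : 𝕜) (f : qHalfLine q → 𝕜) (hf : MemL2 f) :
    MemL2 (c • f) ∧ l2Norm (c • f) = ‖c‖ * l2Norm f := by
  rw [memL2_iff] at *
  have e : ∀ n : ℤ, q ^ n * ‖(c • f) (qPt q n)‖ ^ 2
      = ‖c‖ ^ 2 * (q ^ n * ‖f (qPt q n)‖ ^ 2) := by
    intro n
    rw [Pi.smul_apply, norm_smul]; ring
  refine ⟨by simpa only [e] using hf.mul_left _, ?_⟩
  simp only [l2Norm, qIntegral, smul_eq_mul] at *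
  simp only [e, tsum_mul_left]
  rw [mul_left_comm, Real.sqrt_mul (by positivity), Real.sqrt_sq (norm_nonneg _)]

/-- The functions in `L²_q(ℝ_{q,+})`, as a submodule of all functions `ℝ_{q,+} → 𝕜`. -/
def l2Submodule : Submodule 𝕜 (qHalfLine q → 𝕜) where
  carrier := {f | MemL2 f}
  add_mem' hf hg := (memL2_add_and_norm _ _ hf hg).1
  zero_mem' := by
    change MemL2 (0 : qHalfLine q → 𝕜)
    rw [memL2_iff]
    simp
  smul_mem' c _ hf := (memL2_smul_and_norm c _ hf).1

/-- The space `L²_q(ℝ_{q,+})` of `𝕜`-valued functions; it carries the topology of its norm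
(below), not that of pointwise convergence. -/
def L2 : Type _ := l2Submodule q 𝕜

instance : AddCommGroup (L2 q 𝕜) := inferInstanceAs (AddCommGroup (l2Submodule q 𝕜))

instance : Module 𝕜 (L2 q 𝕜) := inferInstanceAs (Module 𝕜 (l2Submodule q 𝕜))

variable {q 𝕜} in
/-- The function underlying an element of `L²_q(ℝ_{q,+})`. -/
def L2.toFun (f : L2 q 𝕜) : qHalfLine q → 𝕜 := f.1

instance : Norm (L2 q 𝕜) := ⟨fun f => l2Norm f.toFun⟩

theorem l2Core : NormedSpace.Core 𝕜 (L2 q 𝕜) where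
  norm_nonneg _ := Real.sqrt_nonneg _
  norm_smul c f := (memL2_smul_and_norm c f.toFun f.2).2
  norm_triangle f g := (memL2_add_and_norm f.toFun g.toFun f.2 g.2).2
  norm_eq_zero_iff f := by
    have h0 := hq.out.1
    have h1 : 0 < 1 - q := by linarith [hq.out.2]
    have hs := (memL2_iff f.toFun).1 f.2
    constructor
    · intro h
      change Real.sqrt ((1 - q) • ∑' n : ℤ, q ^ n • ‖f.toFun (qPt q n)‖ ^ 2) = 0 at h
      simp only [smul_eq_mul] at h
      have hnn : ∀ n : ℤ, 0 ≤ q ^ n * ‖f.toFun (qPt q n)‖ ^ 2 := fun n => by positivity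
      rw [Real.sqrt_eq_zero (mul_nonneg h1.le (tsum_nonneg hnn)), mul_eq_zero] at h
      have h2 := (hasSum_zero_iff_of_nonneg hnn).1
        ((h.resolve_left h1.ne') ▸ hs.hasSum)
      refine Subtype.ext (funext fun x => ?_)
      obtain ⟨x, n, rfl⟩ := x
      have h3 := congrFun h2 n
      have h4 : ‖f.toFun (qPt q n)‖ ^ 2 = 0 :=
        (mul_eq_zero.1 h3).resolve_left (zpow_pos h0 n).ne'
      exact norm_eq_zero.1 (pow_eq_zero_iff two_ne_zero |>.1 h4)
    · rintro rfl
      change Real.sqrt ((1 - q) • ∑' n : ℤ, q ^ n • ‖(0 : 𝕜)‖ ^ 2) = 0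
      simp

instance : NormedAddCommGroup (L2 q 𝕜) := NormedAddCommGroup.ofCore (l2Core q 𝕜)

instance : NormedSpace 𝕜 (L2 q 𝕜) := NormedSpace.ofCore (l2Core q 𝕜)

end Space

end QFourier

end

/-! Put r = √q, Q = q² = r⁴ and 1 - q = q^k with k an integer. The map f ↦ (r^n f(q^n))_n identifies
L²_q with ℓ²(ℤ), up to the factor 1 - q in the squared norm. Under it the q-sine transform becomes
q·H, where H has kernel a(m + n + k - 1) for a fixed real sequence a (`weighted_qSineTransform`).
Everything reduces to H being an isometric involution.

For such a Hankel kernel with a in ℓ¹, both properties follow from the autocorrelation identity ∑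
a(n) a(n + j) = δ_{j,0} (`hankel_hankel`, `tsum_norm_hankel_sq`). It expresses that the Fourier
symbol of a is unimodular.

To see this, the sine series on the lattice is written as ∑ e_n Q^{(N+k)n} (q³Q^n; Q)_∞, with e_n
the coefficients of (x; Q)_∞. A symmetry exchanges the two arguments
(`tsum_eulerCoeff_qPochInf_comm`), and (Q^{m+1}; Q)_∞ is (Q; Q)_∞ times a coefficient of 1/(x; Q)_∞.
Hence a has symbol E(1/z)/E(z) with E(z) = (r³z; Q)_∞, of modulus 1 on |z| = 1 because E has real
coefficients. The argument uses only the coefficient form of E · (1/E) = 1 (`tsum_crossCorr_mul`).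
-/

noncomputable section
namespace QFourier

/-! ### Autocorrelation of a sequence with unimodular symbol. -/

section Autocorrelation

variable {E : ℕ → ℝ} {B : ℤ → ℝ}

/-- The cross-correlation of a one-sided sequence with a two-sided one. -/
def crossCorr (E : ℕ → ℝ) (B : ℤ → ℝ) (n : ℤ) : ℝ := ∑' j : ℕ, E j * B (n + j)

theorem summable_crossCorr_kernel (hE : Summable fun j => ‖E j‖) (hB : Summable fun n => ‖B n‖) :
    Summable fun p : ℤ × ℕ => ‖E p.2 * B (p.1 + p.2)‖ := by
  have h : Summable fun p : ℕ × ℤ => ‖E p.1‖ * ‖B p.2‖ :=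
    hE.mul_of_nonneg hB (fun _ => norm_nonneg _) (fun _ => norm_nonneg _)
  let e : ℤ × ℕ ≃ ℕ × ℤ :=
    { toFun := fun p => (p.2, p.1 + p.2)
      invFun := fun p => (p.2 - p.1, p.1)
      left_inv := fun p => by simp
      right_inv := fun p => by simp }
  refine (e.summable_iff.2 h).congr fun p => ?_
  simp [e]

theorem summable_norm_crossCorr (hE : Summable fun j => ‖E j‖) (hB : Summable fun n => ‖B n‖) :
    Summable fun n => ‖crossCorr E B n‖ := by
  have h := summable_crossCorr_kernel hE hB
  refine Summable.of_nonneg_of_le (fun _ => norm_nonneg _) (fun n => ?_) h.prod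
  exact norm_tsum_le_tsum_norm (h.prod_factor n)

/-- Hypothesis `hEB` says E(z)B(z) = 1 for the generating series. The cross-correlation has symbol
E(1/z)B(z), whose product with its reflection under z ↦ 1/z is therefore 1. -/
theorem tsum_crossCorr_mul (hE : Summable fun j => ‖E j‖) (hB : Summable fun n => ‖B n‖)
    (hEB : ∀ s : ℤ, ∑' k : ℕ, E k * B (s - k) = if s = 0 then 1 else 0) (j : ℤ) :
    ∑' n, crossCorr E B n * crossCorr E B (n + j) = if j = 0 then 1 else 0 := by
  have h := summable_crossCorr_kernel hE hB
  have hBb : ∀ n, ‖B n‖ ≤ ∑' n, ‖B n‖ := fun n => hB.le_tsum n fun _ _ => norm_nonneg _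
  have hpt : ∀ n, Summable fun k : ℕ => ‖E k * B (n + k)‖ := fun n => h.prod_factor n
  let F : ℤ × ℕ × ℕ → ℝ := fun p =>
    (E p.2.1 * B (p.1 + p.2.1)) * (E p.2.2 * B (p.1 + j + p.2.2))
  have hF : Summable F := by
    have h1 : Summable fun p : (ℤ × ℕ) × ℕ => ‖E p.1.2 * B (p.1.1 + p.1.2)‖ * ‖E p.2‖ :=
      h.mul_of_nonneg hE (fun _ => norm_nonneg _) (fun _ => norm_nonneg _)
    have h2 := (Equiv.prodAssoc ℤ ℕ ℕ).symm.summable_iff.2 (h1.mul_right (∑' n, ‖B n‖))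
    refine Summable.of_norm_bounded h2 fun p => ?_
    simp only [F, Function.comp, Equiv.prodAssoc_symm_apply, norm_mul, ← mul_assoc]
    exact mul_le_mul_of_nonneg_left (hBb _) (by positivity)
  -- Substituting n = s - k - l turns E_k B(n+k) E_l B(n+j+l) into E_k B(s+j-k) · E_l B(s-l), so for
  -- fixed s the sum splits into two convolutions, with k and l exchanged.
  let e : ℤ × ℕ × ℕ ≃ ℤ × ℕ × ℕ :=
    { toFun := fun p => (p.1 - p.2.1 - p.2.2, p.2)
      invFun := fun p => (p.1 + p.2.1 + p.2.2, p.2)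
      left_inv := fun p => Prod.ext (by ring) rfl
      right_inv := fun p => Prod.ext (by ring) rfl }
  have hFe : Summable (F ∘ e) := e.summable_iff.2 hF
  have hL : ∑' p, F p = ∑' n, crossCorr E B n * crossCorr E B (n + j) := by
    rw [hF.tsum_prod]
    refine tsum_congr fun n => ?_
    rw [crossCorr, crossCorr, tsum_mul_tsum_of_summable_norm (hpt n) (hpt (n + j))]
  rw [← hL, ← e.tsum_eq]
  refine (Summable.tsum_prod hFe).trans ?_
  simp only [Function.comp]
  have hs : ∀ s : ℤ, Summable fun k : ℕ => ‖E k * B (s - k)‖ := fun s => by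
    refine Summable.of_nonneg_of_le (fun _ => norm_nonneg _) (fun k => ?_)
      (hE.mul_right (∑' n, ‖B n‖))
    rw [norm_mul]
    exact mul_le_mul_of_nonneg_left (hBb _) (norm_nonneg _)
  have hinner : ∀ s : ℤ, ∑' c : ℕ × ℕ, F (e (s, c)) =
      (if s = 0 then 1 else 0) * (if s + j = 0 then 1 else 0) := fun s => by
    rw [← hEB s, ← hEB (s + j), tsum_mul_tsum_of_summable_norm (hs s) (hs (s + j)),
      ← (Equiv.prodComm ℕ ℕ).tsum_eq]
    refine tsum_congr fun c => ?_
    simp only [F, e, Equiv.coe_fn_mk, Equiv.prodComm_apply, Prod.fst_swap, Prod.snd_swap]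
    have e1 : s - (c.2 : ℤ) - c.1 + c.2 = s - c.1 := by ring
    have e2 : s - (c.2 : ℤ) - c.1 + j + c.1 = s + j - c.2 := by ring
    rw [e1, e2]
    ring
  rw [tsum_congr hinner, tsum_eq_single 0 fun s hs => by simp [hs]]
  simp

end Autocorrelation

/-! ### Hankel operators on ℓ²(ℤ) with summable symbol. -/

section Hankel

variable {𝕜 : Type*} [RCLike 𝕜] {a : ℤ → ℝ}

/-- The Hankel operator with symbol `a` on two-sided sequences. -/
def hankel (a : ℤ → ℝ) (f : ℤ → 𝕜) (m : ℤ) : 𝕜 := ∑' n, (a (m + n) : 𝕜) * f n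

theorem norm_le_of_summable_sq {f : ℤ → 𝕜} (hf : Summable fun n => ‖f n‖ ^ 2) (n : ℤ) :
    ‖f n‖ ≤ 1 + ∑' n, ‖f n‖ ^ 2 := by
  have := hf.le_tsum n fun _ _ => by positivity
  nlinarith [sq_nonneg (‖f n‖ - 1), norm_nonneg (f n)]

theorem summable_shift (ha : Summable fun n => ‖a n‖) (m : ℤ) :
    Summable fun n => ‖a (m + n)‖ :=
  ((Equiv.addLeft m).summable_iff (f := fun n => ‖a n‖)).2 ha

theorem summable_norm_comp_add (ha : Summable fun n => ‖a n‖) (c : ℤ) :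
    Summable fun n => ‖a (n + c)‖ :=
  ((Equiv.addRight c).summable_iff (f := fun n => ‖a n‖)).2 ha

theorem summable_hankel_kernel (ha : Summable fun n => ‖a n‖) {u : ℤ → ℝ} (hu0 : ∀ n, 0 ≤ u n)
    (hu : Summable u) : Summable fun p : ℤ × ℤ => ‖a (p.1 + p.2)‖ * u p.2 := by
  have h := ha.mul_of_nonneg hu (fun _ => norm_nonneg _) hu0
  let e : ℤ × ℤ ≃ ℤ × ℤ :=
    { toFun := fun p => (p.1 + p.2, p.2)
      invFun := fun p => (p.1 - p.2, p.2)
      left_inv := fun p => by simp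
      right_inv := fun p => by simp }
  exact (e.summable_iff (f := fun p : ℤ × ℤ => ‖a p.1‖ * u p.2)).2 h

theorem summable_norm_hankel_term (ha : Summable fun n => ‖a n‖) {f : ℤ → 𝕜}
    (hf : Summable fun n => ‖f n‖ ^ 2) (m : ℤ) :
    Summable fun n => ‖(a (m + n) : 𝕜) * f n‖ := by
  refine Summable.of_nonneg_of_le (fun _ => norm_nonneg _) (fun n => ?_)
    ((summable_shift ha m).mul_right (1 + ∑' n, ‖f n‖ ^ 2))
  rw [norm_mul, RCLike.norm_ofReal, ← Real.norm_eq_abs]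
  exact mul_le_mul_of_nonneg_left (norm_le_of_summable_sq hf n) (norm_nonneg _)

/-- Weighted Cauchy–Schwarz, passed to the limit from finite sums; it drives the Schur-type bound
for the Hankel operator. -/
theorem sq_tsum_mul_le {w u : ℤ → ℝ} (hw0 : ∀ n, 0 ≤ w n)
    (hw : Summable w) (h1 : Summable fun n => w n * u n) (h2 : Summable fun n => w n * u n ^ 2) :
    (∑' n, w n * u n) ^ 2 ≤ (∑' n, w n) * ∑' n, w n * u n ^ 2 := by
  refine le_of_tendsto_of_tendsto (Filter.Tendsto.pow h1.hasSum 2)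
    (Filter.Tendsto.mul hw.hasSum h2.hasSum) ?_
  refine Filter.Eventually.of_forall fun s => ?_
  refine Finset.sum_sq_le_sum_mul_sum_of_sq_le_mul s (fun i _ => hw0 i)
    (fun i _ => mul_nonneg (hw0 i) (sq_nonneg _)) fun i _ => le_of_eq (by ring)

theorem summable_norm_hankel_sq (ha : Summable fun n => ‖a n‖) {f : ℤ → 𝕜}
    (hf : Summable fun n => ‖f n‖ ^ 2) : Summable fun m => ‖hankel a f m‖ ^ 2 := by
  have hk := summable_hankel_kernel ha (fun n => sq_nonneg ‖f n‖) hf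
  refine Summable.of_nonneg_of_le (fun _ => by positivity) (fun m => ?_)
    (hk.prod.mul_left (∑' n, ‖a n‖))
  have ht := summable_norm_hankel_term ha hf m
  have e : ∀ n, ‖(a (m + n) : 𝕜) * f n‖ = ‖a (m + n)‖ * ‖f n‖ := fun n => by
    rw [norm_mul, RCLike.norm_ofReal, ← Real.norm_eq_abs]
  calc ‖hankel a f m‖ ^ 2 ≤ (∑' n, ‖(a (m + n) : 𝕜) * f n‖) ^ 2 := by
        gcongr; exact norm_tsum_le_tsum_norm ht
    _ = (∑' n, ‖a (m + n)‖ * ‖f n‖) ^ 2 := by rw [tsum_congr e]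
    _ ≤ (∑' n, ‖a (m + n)‖) * ∑' n, ‖a (m + n)‖ * ‖f n‖ ^ 2 :=
        sq_tsum_mul_le (fun _ => norm_nonneg _) (summable_shift ha m) (ht.congr e)
          (hk.prod_factor m)
    _ = _ := by
        congr 1
        exact (Equiv.addLeft m).tsum_eq fun n => ‖a n‖

/-- After Fubini, the sum over the middle index is the autocorrelation of a at lag k - m, leaving
only k = m. -/
theorem hankel_hankel (ha : Summable fun n => ‖a n‖)
    (hac : ∀ j, ∑' n, a n * a (n + j) = if j = 0 then 1 else 0) {f : ℤ → 𝕜}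
    (hf : Summable fun n => ‖f n‖ ^ 2) : hankel a (hankel a f) = f := by
  funext m
  have hS : Summable fun p : ℤ × ℤ =>
      (a (m + p.1) : 𝕜) * ((a (p.1 + p.2) : 𝕜) * f p.2) := by
    have h1 := (Equiv.prodComm ℤ ℤ).summable_iff.2
      (summable_hankel_kernel ha (fun n => norm_nonneg (a (m + n))) (summable_shift ha m))
    refine Summable.of_norm_bounded (h1.mul_right (1 + ∑' n, ‖f n‖ ^ 2)) fun p => ?_
    simp only [norm_mul, RCLike.norm_ofReal, Function.comp, Equiv.prodComm_apply, Prod.fst_swap,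
      Prod.snd_swap, Real.norm_eq_abs]
    rw [← mul_assoc, mul_comm |a (m + p.1)|, add_comm p.2]
    exact mul_le_mul_of_nonneg_left (norm_le_of_summable_sq hf _) (by positivity)
  have hL : hankel a (hankel a f) m =
      ∑' n, ∑' k, (a (m + n) : 𝕜) * ((a (n + k) : 𝕜) * f k) := by
    simp only [hankel, tsum_mul_left]
  rw [hL, ← Summable.tsum_comm
    (f := fun n k => (a (m + n) : 𝕜) * ((a (n + k) : 𝕜) * f k)) hS]
  have hin : ∀ k, ∑' n, (a (m + n) : 𝕜) * ((a (n + k) : 𝕜) * f k) =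
      (if k = m then 1 else 0) * f k := fun k => by
    simp only [← mul_assoc, tsum_mul_right]
    congr 1
    have := hac (k - m)
    rw [← (Equiv.addLeft m).tsum_eq] at this
    simp only [Equiv.coe_addLeft, sub_eq_zero] at this
    have h2 : ∀ n, a (m + n + (k - m)) = a (n + k) := fun n => by congr 1; ring
    simp only [h2] at this
    calc ∑' n, (a (m + n) : 𝕜) * (a (n + k) : 𝕜)
        = ((∑' n, a (m + n) * a (n + k) : ℝ) : 𝕜) := by
          rw [RCLike.ofReal_tsum]; push_cast; rfl
      _ = _ := by rw [this]; split_ifs <;> simp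
  rw [tsum_congr hin, tsum_eq_single m fun k hk => by simp [hk]]
  simp

-- The kernel is real and symmetric, so ⟨Hf, Hf⟩ = ⟨HHf, f⟩ = ⟨f, f⟩. Fubini is justified by
-- bounding the product of norms by the sum of their squares, each summable against the ℓ¹ kernel.
open ComplexConjugate in
theorem tsum_norm_hankel_sq (ha : Summable fun n => ‖a n‖)
    (hac : ∀ j, ∑' n, a n * a (n + j) = if j = 0 then 1 else 0) {f : ℤ → 𝕜}
    (hf : Summable fun n => ‖f n‖ ^ 2) : ∑' m, ‖hankel a f m‖ ^ 2 = ∑' n, ‖f n‖ ^ 2 := by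
  have hg := summable_norm_hankel_sq ha hf
  have hS : Summable fun p : ℤ × ℤ =>
      conj (hankel a f p.1) * ((a (p.1 + p.2) : 𝕜) * f p.2) := by
    have h1 := summable_hankel_kernel ha (fun n => sq_nonneg ‖f n‖) hf
    have h2 := (Equiv.prodComm ℤ ℤ).summable_iff.2
      (summable_hankel_kernel ha (fun n => sq_nonneg ‖hankel a f n‖) hg)
    refine Summable.of_norm_bounded (h1.add h2) fun p => ?_
    simp only [norm_mul, RCLike.norm_ofReal, Function.comp, Equiv.prodComm_apply, Prod.fst_swap,
      Prod.snd_swap, Real.norm_eq_abs, RCLike.norm_conj]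
    rw [add_comm p.2, ← mul_add, mul_left_comm]
    refine mul_le_mul_of_nonneg_left ?_ (abs_nonneg _)
    nlinarith [sq_nonneg (‖hankel a f p.1‖ - ‖f p.2‖), sq_nonneg (‖hankel a f p.1‖),
      sq_nonneg (‖f p.2‖)]
  have h3 := (Summable.tsum_comm
    (f := fun m n => conj (hankel a f m) * ((a (m + n) : 𝕜) * f n)) hS).symm
  have hl : ∀ m, ∑' n, conj (hankel a f m) * ((a (m + n) : 𝕜) * f n) =
      ((‖hankel a f m‖ ^ 2 : ℝ) : 𝕜) := fun m => by
    rw [tsum_mul_left]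
    change conj (hankel a f m) * hankel a f m = _
    rw [RCLike.conj_mul]; push_cast; rfl
  have hr : ∀ n, ∑' m, conj (hankel a f m) * ((a (m + n) : 𝕜) * f n) =
      ((‖f n‖ ^ 2 : ℝ) : 𝕜) := fun n => by
    have h4 : conj (hankel a (hankel a f) n) = conj (f n) := by rw [hankel_hankel ha hac hf]
    rw [hankel, RCLike.conj_tsum] at h4
    push_cast
    rw [← RCLike.conj_mul, ← h4, ← tsum_mul_right]
    refine tsum_congr fun m => ?_
    rw [map_mul, RCLike.conj_ofReal, add_comm n]
    ring
  rw [tsum_congr hl, tsum_congr hr, ← RCLike.ofReal_tsum, ← RCLike.ofReal_tsum] at h3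
  exact_mod_cast h3

end Hankel

/-! ### Euler's expansions of (x; Q)_∞ and its reciprocal. -/

section EulerExpansion

variable {Q : ℝ}

theorem qPoch_succ (a q : ℝ) (n : ℕ) : qPoch a q (n + 1) = qPoch a q n * (1 - a * q ^ n) :=
  Finset.prod_range_succ _ _

theorem one_sub_pow_succ_pos (h0 : 0 < Q) (h1 : Q < 1) (n : ℕ) : 0 < 1 - Q ^ (n + 1) :=
  sub_pos.2 (pow_lt_one₀ h0.le h1 n.succ_ne_zero)

theorem qPoch_self_pos (h0 : 0 < Q) (h1 : Q < 1) (n : ℕ) : 0 < qPoch Q Q n :=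
  Finset.prod_pos fun k _ => by
    rw [← pow_succ']; exact one_sub_pow_succ_pos h0 h1 k

/-- The coefficients of Euler's expansion of `(x; Q)_∞` in powers of `x`. -/
def eulerCoeff (Q : ℝ) (j : ℕ) : ℝ := (-1) ^ j * Q ^ j.choose 2 / qPoch Q Q j

/-- The coefficients of Euler's expansion of `1 / (x; Q)_∞`, indexed by `ℤ`. -/
def eulerInvCoeff (Q : ℝ) (m : ℤ) : ℝ := if 0 ≤ m then 1 / qPoch Q Q m.toNat else 0

theorem eulerCoeff_zero : eulerCoeff Q 0 = 1 := by simp [eulerCoeff, qPoch]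

theorem eulerCoeff_succ_mul (h0 : 0 < Q) (h1 : Q < 1) (j : ℕ) :
    eulerCoeff Q (j + 1) * (1 - Q ^ (j + 1)) = -(Q ^ j * eulerCoeff Q j) := by
  have hp := (qPoch_self_pos h0 h1 j).ne'
  have hs := (one_sub_pow_succ_pos h0 h1 j).ne'
  rw [eulerCoeff, eulerCoeff, qPoch_succ, ← pow_succ', Nat.choose_succ_succ' j 1,
    Nat.choose_one_right]
  field_simp
  ring

theorem eulerInvCoeff_natCast (m : ℕ) : eulerInvCoeff Q m = 1 / qPoch Q Q m := by
  simp [eulerInvCoeff]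

theorem eulerInvCoeff_of_neg {m : ℤ} (hm : m < 0) : eulerInvCoeff Q m = 0 := by
  simp [eulerInvCoeff, not_le.2 hm]

/-- Extension by zero makes the recurrence hold on all of ℤ: at m = 0 the factor 1 - Q^0 vanishes.
-/
theorem eulerInvCoeff_mul (h0 : 0 < Q) (h1 : Q < 1) (m : ℤ) :
    eulerInvCoeff Q m * (1 - Q ^ m) = eulerInvCoeff Q (m - 1) := by
  rcases lt_trichotomy m 0 with h | rfl | h
  · rw [eulerInvCoeff_of_neg h, eulerInvCoeff_of_neg (by omega), zero_mul]
  · rw [eulerInvCoeff_of_neg (show (0 : ℤ) - 1 < 0 by norm_num)]; simp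
  · obtain ⟨n, rfl⟩ : ∃ n : ℕ, m = (n + 1 : ℕ) := ⟨(m - 1).toNat, by omega⟩
    have e : ((n + 1 : ℕ) : ℤ) - 1 = n := by push_cast; ring
    have hp := (qPoch_self_pos h0 h1 n).ne'
    have hs := (one_sub_pow_succ_pos h0 h1 n).ne'
    rw [e, eulerInvCoeff_natCast, eulerInvCoeff_natCast, qPoch_succ, zpow_natCast, ← pow_succ']
    field_simp

theorem summable_norm_eulerCoeff (h0 : 0 < Q) (h1 : Q < 1) (x : ℝ) :
    Summable fun j => ‖eulerCoeff Q j * x ^ j‖ := by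
  refine Summable.norm (summable_of_ratio_norm_eventually_le (r := 1 / 2) (by norm_num) ?_)
  have ht : Filter.Tendsto (fun j : ℕ => Q ^ j * (|x| / (1 - Q))) Filter.atTop (nhds 0) := by
    simpa using (tendsto_pow_atTop_nhds_zero_of_lt_one h0.le h1).mul_const (|x| / (1 - Q))
  filter_upwards [ht.eventually_le_const (show (0 : ℝ) < 1 / 2 by norm_num)] with j hj
  have hs := one_sub_pow_succ_pos h0 h1 j
  have hQ : 0 < 1 - Q := by linarith
  have e : eulerCoeff Q (j + 1) * x ^ (j + 1) =
      -(Q ^ j * (x / (1 - Q ^ (j + 1)))) * (eulerCoeff Q j * x ^ j) := by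
    have := eulerCoeff_succ_mul h0 h1 j
    rw [← eq_div_iff hs.ne'] at this
    rw [this]; ring
  rw [e, norm_mul]
  refine mul_le_mul_of_nonneg_right (le_trans ?_ hj) (norm_nonneg _)
  rw [norm_neg, Real.norm_eq_abs, abs_mul, abs_div, abs_of_pos hs, abs_of_pos (pow_pos h0 j)]
  have : Q ^ (j + 1) ≤ Q := by
    simpa using pow_le_pow_of_le_one h0.le h1.le (Nat.le_add_left 1 j)
  gcongr

theorem summable_norm_eulerInvCoeff (h0 : 0 < Q) (h1 : Q < 1) {x : ℝ} (hx0 : 0 < x)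
    (hx : x < 1) : Summable fun m : ℤ => ‖eulerInvCoeff Q m * x ^ m‖ := by
  refine Summable.of_nat_of_neg_add_one ?_ ?_
  · refine Summable.norm (summable_of_ratio_norm_eventually_le (r := (1 + x) / 2)
      (by linarith) ?_)
    have ht : Filter.Tendsto (fun j : ℕ => x / (1 - Q ^ (j + 1))) Filter.atTop (nhds x) := by
      have h := (tendsto_pow_atTop_nhds_zero_of_lt_one h0.le h1).comp
        (Filter.tendsto_add_atTop_nat 1)
      have h2 := (tendsto_const_nhds (x := x)).div (h.const_sub 1) (by simp)
      rwa [sub_zero, div_one] at h2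
    filter_upwards [ht.eventually_le_const (show x < (1 + x) / 2 by linarith)] with j hj
    have hs := one_sub_pow_succ_pos h0 h1 j
    have hp := qPoch_self_pos h0 h1 j
    have e : eulerInvCoeff Q (j + 1 : ℕ) * x ^ ((j + 1 : ℕ) : ℤ) =
        x / (1 - Q ^ (j + 1)) * (eulerInvCoeff Q j * x ^ (j : ℤ)) := by
      rw [eulerInvCoeff_natCast, eulerInvCoeff_natCast, qPoch_succ, ← pow_succ', zpow_natCast,
        zpow_natCast]
      field_simp
      ring
    rw [e, norm_mul]
    refine mul_le_mul_of_nonneg_right (le_trans ?_ hj) (norm_nonneg _)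
    rw [Real.norm_of_nonneg (div_nonneg hx0.le hs.le)]
  · refine summable_zero.congr fun n => ?_
    rw [eulerInvCoeff_of_neg (by omega)]; simp

theorem tsum_eulerCoeff_mul_eulerInvCoeff (h0 : 0 < Q) (h1 : Q < 1) (s : ℤ) :
    ∑' k : ℕ, eulerCoeff Q k * eulerInvCoeff Q (s - k) = if s = 0 then 1 else 0 := by
  rcases lt_trichotomy s 0 with h | rfl | h
  · rw [if_neg h.ne, tsum_congr (g := fun _ => (0 : ℝ)), tsum_zero]
    intro k
    rw [eulerInvCoeff_of_neg (by omega), mul_zero]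
  · rw [tsum_eq_single 0]
    · simp [eulerCoeff_zero, eulerInvCoeff, qPoch]
    · intro k hk
      rw [eulerInvCoeff_of_neg (by omega), mul_zero]
  · rw [if_neg h.ne']
    have hfin : ∀ g : ℕ → ℝ, ∀ t ≤ s, Summable fun k : ℕ => g k * eulerInvCoeff Q (t - k) := by
      intro g t ht
      refine summable_of_ne_finset_zero (s := Finset.range (s.toNat + 1)) fun k hk => ?_
      rw [eulerInvCoeff_of_neg, mul_zero]
      simp only [Finset.mem_range] at hk
      omega
    have hs : 1 - Q ^ s ≠ 0 := by
      lift s to ℕ using h.le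
      obtain ⟨n, rfl⟩ := Nat.exists_eq_succ_of_ne_zero (n := s) (by omega)
      rw [zpow_natCast]
      exact (one_sub_pow_succ_pos h0 h1 n).ne'
    refine (mul_eq_zero.1 ?_).resolve_right hs
    rw [← tsum_mul_right]
    -- Splitting 1 - Q^s = (1 - Q^k) + Q^k (1 - Q^{s-k}) lets each factor act through its own
    -- recurrence; the two resulting sums cancel after shifting k by one.
    have e : ∀ k : ℕ, eulerCoeff Q k * eulerInvCoeff Q (s - k) * (1 - Q ^ s) =
        eulerCoeff Q k * (1 - Q ^ k) * eulerInvCoeff Q (s - k) +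
        Q ^ k * eulerCoeff Q k * eulerInvCoeff Q (s - 1 - k) := fun k => by
      rw [sub_right_comm s 1, ← eulerInvCoeff_mul h0 h1 (s - k), zpow_sub₀ h0.ne', zpow_natCast]
      have := (pow_pos h0 k).ne'
      field_simp
      ring
    rw [tsum_congr e, (hfin _ s le_rfl).tsum_add (hfin _ (s - 1) (by omega)),
      (hfin _ s le_rfl).tsum_eq_zero_add]
    have e2 : ∀ k : ℕ, eulerCoeff Q (k + 1) * (1 - Q ^ (k + 1)) *
        eulerInvCoeff Q (s - (k + 1 : ℕ)) =
        -(Q ^ k * eulerCoeff Q k * eulerInvCoeff Q (s - 1 - k)) := fun k => by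
      rw [eulerCoeff_succ_mul h0 h1, neg_mul]
      push_cast
      rw [← sub_sub, sub_right_comm s]
    rw [tsum_congr e2, tsum_neg]
    simp

/-- Euler's series for `(x; Q)_∞`. -/
def eulerSeries (Q x : ℝ) : ℝ := ∑' j, eulerCoeff Q j * x ^ j

theorem eulerSeries_eq_mul (h0 : 0 < Q) (h1 : Q < 1) (x : ℝ) :
    eulerSeries Q x = (1 - x) * eulerSeries Q (x * Q) := by
  have hs := (summable_norm_eulerCoeff h0 h1 x).of_norm
  have hs' := (summable_norm_eulerCoeff h0 h1 (x * Q)).of_norm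
  have e : ∀ j, eulerCoeff Q (j + 1) * x ^ (j + 1) =
      eulerCoeff Q (j + 1) * (x * Q) ^ (j + 1) - x * (eulerCoeff Q j * (x * Q) ^ j) := fun j => by
    have := eulerCoeff_succ_mul h0 h1 j
    linear_combination x ^ (j + 1) * this
  have hs1 := (summable_nat_add_iff 1).2 hs'
  rw [sub_mul, one_mul]
  conv_lhs => rw [eulerSeries, hs.tsum_eq_zero_add]
  conv_rhs => arg 1; rw [eulerSeries, hs'.tsum_eq_zero_add]
  rw [tsum_congr e, hs1.tsum_sub (hs'.mul_left x), tsum_mul_left, eulerSeries]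
  simp
  ring

theorem eulerSeries_eq_qPoch_mul (h0 : 0 < Q) (h1 : Q < 1) (x : ℝ) (n : ℕ) :
    eulerSeries Q x = qPoch x Q n * eulerSeries Q (x * Q ^ n) := by
  induction n with
  | zero => simp [qPoch]
  | succ n ih =>
    rw [ih, eulerSeries_eq_mul h0 h1 (x * Q ^ n), qPoch_succ, pow_succ]
    ring_nf

theorem tendsto_eulerSeries (h0 : 0 < Q) (h1 : Q < 1) (x : ℝ) :
    Filter.Tendsto (fun n : ℕ => eulerSeries Q (x * Q ^ n)) Filter.atTop (nhds 1) := by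
  have h : Filter.Tendsto (fun n : ℕ => ∑' j, eulerCoeff Q j * (x * Q ^ n) ^ j) Filter.atTop
      (nhds (∑' j, eulerCoeff Q j * (x * 0) ^ j)) := by
    refine tendsto_tsum_of_dominated_convergence (summable_norm_eulerCoeff h0 h1 x)
      (fun j => ?_) (Filter.Eventually.of_forall fun n j => ?_)
    · exact (((tendsto_pow_atTop_nhds_zero_of_lt_one h0.le h1).const_mul x).pow j).const_mul _
    · rw [norm_mul, norm_mul, norm_pow, norm_pow, norm_mul]
      have : ‖Q ^ n‖ ≤ 1 := by
        rw [Real.norm_of_nonneg (pow_pos h0 n).le]; exact pow_le_one₀ h0.le h1.le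
      gcongr
      exact mul_le_of_le_one_right (norm_nonneg _) this
  rw [tsum_eq_single 0 fun j hj => by simp [hj]] at h
  simp only [pow_zero, mul_one, eulerCoeff_zero] at h
  exact h

/-- Iterating the functional equation S(x) = (1 - x) S(xQ) extracts the finite products, and the
remaining factor S(xQ^n) tends to 1. -/
theorem qPochInf_eq_eulerSeries (h0 : 0 < Q) (h1 : Q < 1) (x : ℝ) :
    qPochInf x Q = eulerSeries Q x := by
  have hm : Multipliable fun k : ℕ => 1 + -(x * Q ^ k) := by
    refine multipliable_one_add_of_summable ?_
    exact ((summable_geometric_of_lt_one h0.le h1).mul_left x).neg.norm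
  have h2 : Filter.Tendsto (fun n => qPoch x Q n) Filter.atTop (nhds (qPochInf x Q)) := by
    have := hm.hasProd.tendsto_prod_nat
    simpa only [qPochInf, qPoch, sub_eq_add_neg] using this
  have h3 := h2.mul (tendsto_eulerSeries h0 h1 x)
  simp only [← eulerSeries_eq_qPoch_mul h0 h1 x, mul_one] at h3
  exact tendsto_nhds_unique h3 tendsto_const_nhds

theorem qPochInf_eq_mul (h0 : 0 < Q) (h1 : Q < 1) (x : ℝ) (n : ℕ) :
    qPochInf x Q = qPoch x Q n * qPochInf (x * Q ^ n) Q := by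
  rw [qPochInf_eq_eulerSeries h0 h1, qPochInf_eq_eulerSeries h0 h1]
  exact eulerSeries_eq_qPoch_mul h0 h1 x n

theorem qPoch_pos (h0 : 0 < Q) (h1 : Q < 1) {x : ℝ} (hx : x < 1) (n : ℕ) :
    0 < qPoch x Q n :=
  Finset.prod_pos fun k _ => by
    have : Q ^ k ≤ 1 := pow_le_one₀ h0.le h1.le
    nlinarith [pow_pos h0 k]

theorem qPochInf_pos (h0 : 0 < Q) (h1 : Q < 1) {x : ℝ} (hx : x < 1) :
    0 < qPochInf x Q := by
  obtain ⟨n, hn⟩ := ((tendsto_eulerSeries h0 h1 x).eventually_const_lt zero_lt_one).exists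
  rw [qPochInf_eq_eulerSeries h0 h1, eulerSeries_eq_qPoch_mul h0 h1 x n]
  exact mul_pos (qPoch_pos h0 h1 hx n) hn

/-- For m < 0 one factor of the product is 1 - Q^0 = 0, which matches the extension of the
coefficients by zero. -/
theorem qPochInf_zpow (h0 : 0 < Q) (h1 : Q < 1) (m : ℤ) :
    qPochInf (Q ^ (m + 1)) Q = qPochInf Q Q * eulerInvCoeff Q m := by
  rcases lt_or_ge m 0 with h | h
  · rw [eulerInvCoeff_of_neg h, mul_zero, qPochInf_eq_mul h0 h1 _ ((-m).toNat)]
    refine mul_eq_zero_of_left (Finset.prod_eq_zero (i := (-m - 1).toNat) ?_ ?_) _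
    · simp only [Finset.mem_range]; omega
    · rw [← zpow_natCast, ← zpow_add₀ h0.ne', show m + 1 + ((-m - 1).toNat : ℤ) = 0 by omega]
      simp
  · lift m to ℕ using h
    have hp := (qPoch_self_pos h0 h1 m).ne'
    rw [eulerInvCoeff_natCast, qPochInf_eq_mul h0 h1 Q m, ← pow_succ', ← Nat.cast_succ,
      zpow_natCast]
    field_simp

/-- The symmetry `∑ e_k z^k (w Q^k; Q)_∞ = ∑ e_k w^k (z Q^k; Q)_∞`, where
`(x; Q)_∞ = ∑ e_k x^k`. -/
theorem tsum_eulerCoeff_qPochInf_comm (h0 : 0 < Q) (h1 : Q < 1) (z w : ℝ) :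
    ∑' k, eulerCoeff Q k * z ^ k * qPochInf (w * Q ^ k) Q =
      ∑' k, eulerCoeff Q k * w ^ k * qPochInf (z * Q ^ k) Q := by
  have hS : Summable fun p : ℕ × ℕ =>
      (eulerCoeff Q p.1 * z ^ p.1) * (eulerCoeff Q p.2 * (w * Q ^ p.1) ^ p.2) := by
    refine Summable.of_norm_bounded
      ((summable_norm_eulerCoeff h0 h1 z).mul_of_nonneg (summable_norm_eulerCoeff h0 h1 w)
        (fun _ => norm_nonneg _) (fun _ => norm_nonneg _)) fun p => ?_
    rw [norm_mul, norm_mul (eulerCoeff Q p.2), norm_mul (eulerCoeff Q p.2), norm_pow (w * _),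
      norm_mul w, norm_pow w]
    have : ‖Q ^ p.1‖ ≤ 1 := by
      rw [Real.norm_of_nonneg (pow_pos h0 _).le]; exact pow_le_one₀ h0.le h1.le
    gcongr
    exact mul_le_of_le_one_right (norm_nonneg _) this
  -- Both sides are the double series ∑ e_k e_j z^k w^j Q^{jk}, summed in opposite orders.
  simp only [qPochInf_eq_eulerSeries h0 h1, eulerSeries, ← tsum_mul_left]
  rw [← Summable.tsum_comm (f := fun k j => (eulerCoeff Q k * z ^ k) *
    (eulerCoeff Q j * (w * Q ^ k) ^ j)) hS]
  refine tsum_congr fun k => tsum_congr fun j => ?_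
  rw [mul_pow, mul_pow, ← pow_mul, ← pow_mul, mul_comm j k]
  ring

end EulerExpansion

/-! ### The q-sine on the lattice and its normalising constant. -/

section SineSymbol

/-- The symbol of the Hankel operator to which the `q`-sine transform is conjugate;
`r` is the square root of `q`. -/
def sineSymbol (r : ℝ) : ℤ → ℝ :=
  crossCorr (fun j => eulerCoeff (r ^ 4) j * (r ^ 3) ^ j)
    (fun m => eulerInvCoeff (r ^ 4) m * (r ^ 3) ^ m)

variable {q r : ℝ}

theorem summable_norm_sineSymbol (h0 : 0 < r) (h1 : r < 1) :
    Summable fun n => ‖sineSymbol r n‖ :=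
  summable_norm_crossCorr
    (summable_norm_eulerCoeff (by positivity) (pow_lt_one₀ h0.le h1 (by norm_num)) _)
    (summable_norm_eulerInvCoeff (by positivity) (pow_lt_one₀ h0.le h1 (by norm_num))
      (by positivity) (pow_lt_one₀ h0.le h1 (by norm_num)))

theorem tsum_sineSymbol_mul (h0 : 0 < r) (h1 : r < 1) (j : ℤ) :
    ∑' n, sineSymbol r n * sineSymbol r (n + j) = if j = 0 then 1 else 0 := by
  have hQ0 : 0 < r ^ 4 := by positivity
  have hQ1 : r ^ 4 < 1 := pow_lt_one₀ h0.le h1 (by norm_num)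
  refine tsum_crossCorr_mul (summable_norm_eulerCoeff hQ0 hQ1 _)
    (summable_norm_eulerInvCoeff hQ0 hQ1 (by positivity)
      (pow_lt_one₀ h0.le h1 (by norm_num))) (fun s => ?_) j
  have e : ∀ k : ℕ, eulerCoeff (r ^ 4) k * (r ^ 3) ^ k *
      (eulerInvCoeff (r ^ 4) (s - k) * (r ^ 3) ^ (s - k)) =
      (r ^ 3) ^ s * (eulerCoeff (r ^ 4) k * eulerInvCoeff (r ^ 4) (s - k)) := fun k => by
    rw [zpow_sub₀ (by positivity), zpow_natCast]
    field_simp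
  rw [tsum_congr e, tsum_mul_left, tsum_eulerCoeff_mul_eulerInvCoeff hQ0 hQ1]
  split_ifs with h <;> simp [h]

/-- The symmetry moves r⁶ into the powers; writing r^{6j} = r^{-3n} · r^{3j} · r^{3(n+j)} shares it
equally between the two Euler expansions, so both are taken at the same scale r³ < 1. -/
theorem tsum_eulerCoeff_eq_sineSymbol (h0 : 0 < r) (h1 : r < 1) (n : ℤ) :
    ∑' k : ℕ, eulerCoeff (r ^ 4) k * ((r ^ 4) ^ (n + 1)) ^ k *
        qPochInf (r ^ 6 * (r ^ 4) ^ k) (r ^ 4) =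
      qPochInf (r ^ 4) (r ^ 4) * (r ^ 3) ^ (-n) * sineSymbol r n := by
  have hQ0 : 0 < r ^ 4 := by positivity
  have hQ1 : r ^ 4 < 1 := pow_lt_one₀ h0.le h1 (by norm_num)
  rw [tsum_eulerCoeff_qPochInf_comm hQ0 hQ1, sineSymbol, crossCorr, ← tsum_mul_left]
  refine tsum_congr fun j => ?_
  rw [← zpow_natCast (r ^ 4) j, ← zpow_add₀ hQ0.ne', add_right_comm, qPochInf_zpow hQ0 hQ1,
    zpow_add₀ (by positivity) n, zpow_neg, zpow_natCast]
  have : (r ^ 3) ^ n ≠ 0 := by positivity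
  field_simp
  ring

theorem qPoch_self_two_mul_add_one (q : ℝ) (n : ℕ) :
    qPoch q q (2 * n + 1) = qPoch (q ^ 2) (q ^ 2) n * qPoch q (q ^ 2) (n + 1) := by
  induction n with
  | zero => simp [qPoch]
  | succ n ih =>
    rw [show 2 * (n + 1) + 1 = 2 * n + 1 + 1 + 1 by ring, qPoch_succ, qPoch_succ, ih,
      qPoch_succ (q ^ 2) _ n, qPoch_succ q (q ^ 2) (n + 1), ← pow_mul, ← pow_mul]
    ring

theorem qSin_zpow (h0 : 0 < r) (h1 : r < 1) (hq : q = r ^ 2) {k : ℤ} (hk : 1 - q = q ^ k)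
    (N : ℤ) :
    qSin q (q ^ N) = qPochInf (r ^ 4) (r ^ 4) / qPochInf q (r ^ 4) * r ^ 3 * r ^ (-(N + k)) *
      sineSymbol r (N + k - 1) := by
  have hQ0 : 0 < r ^ 4 := by positivity
  have hQ1 : r ^ 4 < 1 := pow_lt_one₀ h0.le h1 (by norm_num)
  have hq0 : 0 < q := by rw [hq]; positivity
  have hq1 : q < 1 := by rw [hq]; exact pow_lt_one₀ h0.le h1 (by norm_num)
  have hqQ : q ^ 2 = r ^ 4 := by rw [hq]; ring
  have hP := qPochInf_pos hQ0 hQ1 hq1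
  have e : ∀ n : ℕ, (-1) ^ n * q ^ (n * (n - 1)) *
      ((q ^ N) ^ (2 * n + 1) / qFactorial q (2 * n + 1)) =
      q ^ (N + k) / qPochInf q (r ^ 4) * (eulerCoeff (r ^ 4) n *
        ((r ^ 4) ^ (N + k - 1 + 1)) ^ n * qPochInf (r ^ 6 * (r ^ 4) ^ n) (r ^ 4)) := fun n => by
    have hsplit := qPochInf_eq_mul hQ0 hQ1 q (n + 1)
    have hA : q * (r ^ 4) ^ (n + 1) = r ^ 6 * (r ^ 4) ^ n := by rw [hq]; ring
    rw [hA] at hsplit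
    have hp1 := qPoch_self_pos hQ0 hQ1 n
    have hp2 := qPoch_pos hQ0 hQ1 hq1 (n + 1)
    have hp3 : 0 < qPochInf (r ^ 6 * (r ^ 4) ^ n) (r ^ 4) := by
      rw [hsplit] at hP
      exact pos_of_mul_pos_right hP hp2.le
    have hc : q ^ (n * (n - 1)) = (r ^ 4) ^ n.choose 2 := by
      rw [← hqQ, ← pow_mul, Nat.choose_two_right,
        Nat.mul_div_cancel' (Nat.even_mul_pred_self n).two_dvd]
    -- With 1 - q = q^k, the powers of 1 - q from the q-factorial only shift the lattice index from
    -- N to N + k.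
    have hz : (q ^ N) ^ (2 * n + 1) * (1 - q) ^ (2 * n + 1) =
        q ^ (N + k) * ((r ^ 4) ^ (N + k)) ^ n := by
      rw [hk, ← mul_pow, ← zpow_add₀ hq0.ne', ← hqQ, pow_succ, pow_mul, ← zpow_natCast (q ^ (N + k)),
        zpow_comm, zpow_natCast, mul_comm]
    rw [qFactorial, qPoch_self_two_mul_add_one, hqQ, hsplit, hc, eulerCoeff, sub_add_cancel,
      div_div_eq_mul_div, hz]
    field_simp
  rw [qSin, tsum_congr e, tsum_mul_left, tsum_eulerCoeff_eq_sineSymbol h0 h1]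
  have hr : q ^ (N + k) * (r ^ 3) ^ (-(N + k - 1)) = r ^ 3 * r ^ (-(N + k)) := by
    rw [hq, ← zpow_natCast r 2, ← zpow_natCast r 3, ← zpow_mul, ← zpow_mul, ← zpow_add₀ h0.ne',
      ← zpow_add₀ h0.ne']
    congr 1
    push_cast
    ring
  linear_combination (qPochInf (r ^ 4) (r ^ 4) / qPochInf q (r ^ 4) *
    sineSymbol r (N + k - 1)) * hr

/-- The factor √(1 - q²) = r^k √(1 + q) in Γ_{q²}(1/2) cancels √(1 + q⁻¹) = √(1 + q)/r up to a power
of r. -/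
theorem cq_mul_qPochInf_div (h0 : 0 < r) (h1 : r < 1) (hq : q = r ^ 2) {k : ℤ}
    (hk : 1 - q = q ^ k) :
    cq q * (qPochInf (r ^ 4) (r ^ 4) / qPochInf q (r ^ 4)) = r ^ (-(1 + k)) := by
  have hQ0 : 0 < r ^ 4 := by positivity
  have hQ1 : r ^ 4 < 1 := pow_lt_one₀ h0.le h1 (by norm_num)
  have hq0 : 0 < q := by rw [hq]; positivity
  have hq1 : q < 1 := by rw [hq]; exact pow_lt_one₀ h0.le h1 (by norm_num)
  have hqQ : q ^ 2 = r ^ 4 := by rw [hq]; ring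
  have hP := qPochInf_pos hQ0 hQ1 hq1
  have hP' := qPochInf_pos hQ0 hQ1 hQ1
  have hrk : (0 : ℝ) < r ^ k := zpow_pos h0 k
  have hs : 0 < √(1 + q) := Real.sqrt_pos.2 (by linarith)
  have e1 : √(1 + q⁻¹) = √(1 + q) / r := by
    rw [show 1 + q⁻¹ = (1 + q) / r ^ 2 by rw [← hq]; field_simp; ring, Real.sqrt_div (by linarith),
      Real.sqrt_sq h0.le]
  have e2 : √(1 - q ^ 2) = r ^ k * √(1 + q) := by
    rw [show 1 - q ^ 2 = (r ^ k) ^ 2 * (1 + q) by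
      rw [← zpow_natCast (r ^ k), zpow_comm, zpow_natCast, ← hq, ← hk]; ring,
      Real.sqrt_mul (by positivity), Real.sqrt_sq hrk.le]
  have e3 : (q ^ 2) ^ (1 / 2 : ℝ) = q := by rw [← Real.sqrt_eq_rpow, Real.sqrt_sq hq0.le]
  rw [cq, qGamma, e3, show (1 : ℝ) - 1 / 2 = 1 / 2 by norm_num, ← Real.sqrt_eq_rpow,
    ← Real.sqrt_eq_rpow, e1, e2, hqQ, zpow_neg, zpow_add₀ h0.ne', zpow_one]
  field_simp

end SineSymbol

/-! ### Transport of the transform to ℓ²(ℤ). -/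

section Conjugation

variable {q r : ℝ} {𝕜 : Type*} [RCLike 𝕜]

/-- The sequence `n ↦ q ^ (n / 2) f(q ^ n)`, with `r` the square root of `q`. -/
def weighted (r : ℝ) (f : qHalfLine q → 𝕜) (n : ℤ) : 𝕜 := ((r ^ n : ℝ) : 𝕜) * f (qPt q n)

theorem zpow_mul_norm_sq_eq (hq : q = r ^ 2) (f : qHalfLine q → 𝕜) (n : ℤ) :
    q ^ n * ‖f (qPt q n)‖ ^ 2 = ‖weighted r f n‖ ^ 2 := by
  rw [weighted, norm_mul, mul_pow, RCLike.norm_ofReal, sq_abs, ← zpow_natCast (r ^ n), zpow_comm,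
    zpow_natCast, ← hq]

theorem memL2_iff_weighted [Fact (0 < q ∧ q < 1)] (hq : q = r ^ 2) (f : qHalfLine q → 𝕜) :
    MemL2 f ↔ Summable fun n => ‖weighted r f n‖ ^ 2 := by
  rw [memL2_iff]
  exact summable_congr (zpow_mul_norm_sq_eq hq f)

theorem l2Norm_eq_weighted (hq : q = r ^ 2) (f : qHalfLine q → 𝕜) :
    l2Norm f = √((1 - q) * ∑' n, ‖weighted r f n‖ ^ 2) := by
  simp only [l2Norm, qIntegral, smul_eq_mul, zpow_mul_norm_sq_eq hq]

theorem weighted_injective (h0 : 0 < r) :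
    Function.Injective (weighted r : (qHalfLine q → 𝕜) → ℤ → 𝕜) := by
  intro f g h
  funext x
  obtain ⟨x, n, rfl⟩ := x
  have hr : ((r ^ n : ℝ) : 𝕜) ≠ 0 := RCLike.ofReal_ne_zero.2 (zpow_pos h0 n).ne'
  exact mul_left_cancel₀ hr (congrFun h n)

/-- The Jackson weight q^n times the factor r^{-(m+n+k)} of the sine is r^{-(m+k)} r^n: the r^n is
absorbed by the weighted sequence, and the rest does not depend on n. -/
theorem kernel_term_eq (h0 : 0 < r) (h1 : r < 1) (hq : q = r ^ 2) {k : ℤ} (hk : 1 - q = q ^ k)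
    (f : qHalfLine q → 𝕜) (m n : ℤ) :
    q ^ n • (f (qPt q n) * (qSin q ((qPt q m : ℝ) * (qPt q n : ℝ)) : 𝕜)) =
      ((qPochInf (r ^ 4) (r ^ 4) / qPochInf q (r ^ 4) * r ^ 3 * r ^ (-(m + k)) : ℝ) : 𝕜) *
        ((sineSymbol r (m + n + k - 1) : 𝕜) * weighted r f n) := by
  have hq0 : 0 < q := by rw [hq]; positivity
  have e : (qPt q m : ℝ) * (qPt q n : ℝ) = q ^ (m + n) := (zpow_add₀ hq0.ne' m n).symm
  have hr : q ^ n * r ^ (-(m + n + k)) = r ^ (-(m + k)) * r ^ n := by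
    rw [hq, ← zpow_natCast r 2, ← zpow_mul, ← zpow_add₀ h0.ne', ← zpow_add₀ h0.ne']
    congr 1
    push_cast
    ring
  rw [e, qSin_zpow h0 h1 hq hk, weighted, RCLike.real_smul_eq_coe_mul]
  have hr' := congrArg (RCLike.ofReal (K := 𝕜)) hr
  simp only [RCLike.ofReal_mul] at hr' ⊢
  linear_combination ((qPochInf (r ^ 4) (r ^ 4) / qPochInf q (r ^ 4) : ℝ) : 𝕜) *
    ((r ^ 3 : ℝ) : 𝕜) * (sineSymbol r (m + n + k - 1) : 𝕜) * f (qPt q n) * hr'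

theorem qIntegrable_kernel (h0 : 0 < r) (h1 : r < 1) (hq : q = r ^ 2) {k : ℤ}
    (hk : 1 - q = q ^ k) {f : qHalfLine q → 𝕜} (hf : Summable fun n => ‖weighted r f n‖ ^ 2)
    (x : qHalfLine q) :
    QIntegrable fun t : qHalfLine q => f t * (qSin q ((x : ℝ) * (t : ℝ)) : 𝕜) := by
  obtain ⟨x, m, rfl⟩ := x
  have h := summable_norm_hankel_term
    (summable_norm_comp_add (summable_norm_sineSymbol h0 h1) (k - 1)) hf m
  refine (h.mul_left ‖((qPochInf (r ^ 4) (r ^ 4) / qPochInf q (r ^ 4) * r ^ 3 *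
    r ^ (-(m + k)) : ℝ) : 𝕜)‖).congr fun n => ?_
  rw [← norm_mul]
  refine congrArg norm ((kernel_term_eq h0 h1 hq hk f m n).trans ?_).symm
  simp only [add_sub_assoc]

theorem weighted_qSineTransform (h0 : 0 < r) (h1 : r < 1) (hq : q = r ^ 2) {k : ℤ}
    (hk : 1 - q = q ^ k) (f : qHalfLine q → 𝕜) :
    weighted r (qSineTransform f) =
      (q : 𝕜) • hankel (fun n => sineSymbol r (n + (k - 1))) (weighted r f) := by
  funext m
  rw [weighted, qSineTransform, qIntegral, tsum_congr (kernel_term_eq h0 h1 hq hk f m),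
    tsum_mul_left, Pi.smul_apply, smul_eq_mul, hankel, RCLike.real_smul_eq_coe_mul]
  simp only [add_sub_assoc]
  have hc := cq_mul_qPochInf_div h0 h1 hq hk
  -- The exponents of r add up to m + 2k + 3 - (m + k) - (1 + k) = 2, which is where the norm factor
  -- q = r² comes from.
  have e : r ^ m * (cq q * ((1 - q) * (qPochInf (r ^ 4) (r ^ 4) / qPochInf q (r ^ 4) * r ^ 3 *
      r ^ (-(m + k))))) = q := by
    calc _ = r ^ m * (1 - q) * r ^ 3 * r ^ (-(m + k)) *
          (cq q * (qPochInf (r ^ 4) (r ^ 4) / qPochInf q (r ^ 4))) := by ring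
      _ = q := by
          rw [hc, hk, hq, ← zpow_natCast r 2, ← zpow_natCast r 3, ← zpow_mul, ← zpow_add₀ h0.ne',
            ← zpow_add₀ h0.ne', ← zpow_add₀ h0.ne', ← zpow_add₀ h0.ne']
          congr 1
          push_cast
          ring
  have e' := congrArg (RCLike.ofReal (K := 𝕜)) e
  rw [← e']
  simp only [RCLike.ofReal_mul]
  ring

theorem tsum_shift_sineSymbol_mul (h0 : 0 < r) (h1 : r < 1) (c j : ℤ) :
    ∑' n, sineSymbol r (n + c) * sineSymbol r (n + j + c) = if j = 0 then 1 else 0 := by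
  rw [← tsum_sineSymbol_mul h0 h1 j,
    ← (Equiv.addRight c).tsum_eq fun n => sineSymbol r n * sineSymbol r (n + j)]
  simp only [Equiv.coe_addRight, add_right_comm]

theorem summable_weighted_qSineTransform (h0 : 0 < r) (h1 : r < 1) (hq : q = r ^ 2) {k : ℤ}
    (hk : 1 - q = q ^ k) {f : qHalfLine q → 𝕜} (hf : Summable fun n => ‖weighted r f n‖ ^ 2) :
    (Summable fun n => ‖weighted r (qSineTransform f) n‖ ^ 2) ∧
      ∑' n, ‖weighted r (qSineTransform f) n‖ ^ 2 = q ^ 2 * ∑' n, ‖weighted r f n‖ ^ 2 := by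
  have ha : Summable fun n => ‖sineSymbol r (n + (k - 1))‖ :=
    summable_norm_comp_add (summable_norm_sineSymbol h0 h1) (k - 1)
  rw [weighted_qSineTransform h0 h1 hq hk,
    ← tsum_norm_hankel_sq ha (tsum_shift_sineSymbol_mul h0 h1 (k - 1)) hf, ← tsum_mul_left]
  simp only [Pi.smul_apply, norm_smul, mul_pow, RCLike.norm_ofReal, sq_abs, and_true]
  exact (summable_norm_hankel_sq ha hf).mul_left _

theorem qSineTransform_qSineTransform (h0 : 0 < r) (h1 : r < 1) (hq : q = r ^ 2) {k : ℤ}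
    (hk : 1 - q = q ^ k) {f : qHalfLine q → 𝕜} (hf : Summable fun n => ‖weighted r f n‖ ^ 2) :
    qSineTransform (qSineTransform f) = (q : 𝕜) ^ 2 • f := by
  have ha : Summable fun n => ‖sineSymbol r (n + (k - 1))‖ :=
    summable_norm_comp_add (summable_norm_sineSymbol h0 h1) (k - 1)
  have hh := hankel_hankel ha (tsum_shift_sineSymbol_mul h0 h1 (k - 1)) hf
  have hl : ∀ g : ℤ → 𝕜, hankel (fun n => sineSymbol r (n + (k - 1))) ((q : 𝕜) • g) =
      (q : 𝕜) • hankel (fun n => sineSymbol r (n + (k - 1))) g := fun g => by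
    funext m
    simp only [hankel, Pi.smul_apply, smul_eq_mul, mul_left_comm, tsum_mul_left]
  refine weighted_injective h0 ?_
  rw [weighted_qSineTransform h0 h1 hq hk, weighted_qSineTransform h0 h1 hq hk, hl, hh, smul_smul,
    ← sq]
  funext n
  simp only [weighted, Pi.smul_apply, smul_eq_mul]
  ring

theorem qSineTransform_add {f g : qHalfLine q → 𝕜}
    (hf : ∀ x : qHalfLine q, QIntegrable fun t : qHalfLine q =>
      f t * (qSin q ((x : ℝ) * (t : ℝ)) : 𝕜))
    (hg : ∀ x : qHalfLine q, QIntegrable fun t : qHalfLine q =>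
      g t * (qSin q ((x : ℝ) * (t : ℝ)) : 𝕜)) :
    qSineTransform (f + g) = qSineTransform f + qSineTransform g := by
  funext x
  simp only [qSineTransform, qIntegral, Pi.add_apply, add_mul, smul_add]
  rw [(hf x).of_norm.tsum_add (hg x).of_norm, smul_add, mul_add]

theorem qSineTransform_smul (c : 𝕜) (f : qHalfLine q → 𝕜) :
    qSineTransform (c • f) = c • qSineTransform f := by
  funext x
  simp only [qSineTransform, qIntegral, Pi.smul_apply, smul_eq_mul, RCLike.real_smul_eq_coe_mul]
  have e : ∀ n : ℤ, ((q ^ n : ℝ) : 𝕜) *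
      (c * f (qPt q n) * (qSin q ((x : ℝ) * (qPt q n : ℝ)) : 𝕜)) =
      c * (((q ^ n : ℝ) : 𝕜) * (f (qPt q n) * (qSin q ((x : ℝ) * (qPt q n : ℝ)) : 𝕜))) :=
    fun n => by ring
  rw [tsum_congr e, tsum_mul_left]
  ring

end Conjugation

theorem one_sub_eq_zpow {q : ℝ} (h0 : 0 < q) (h1 : q < 1) {k : ℤ}
    (hk : Real.log (1 - q) / Real.log q = k) : 1 - q = q ^ k := by
  have hl : Real.log q ≠ 0 := (Real.log_neg h0 h1).ne
  rw [div_eq_iff hl, ← Real.log_zpow] at hk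
  exact Real.log_injOn_pos (Set.mem_Ioi.2 (by linarith)) (Set.mem_Ioi.2 (zpow_pos h0 k)) hk

/-! ### The transform as a linear homeomorphism of L²_q. -/

section L2Operator

variable {q : ℝ} [Fact (0 < q ∧ q < 1)] {𝕜 : Type*} [RCLike 𝕜]

theorem L2.toFun_injective : Function.Injective (L2.toFun : L2 q 𝕜 → qHalfLine q → 𝕜) :=
  Subtype.val_injective

theorem L2.memL2 (f : L2 q 𝕜) : MemL2 f.toFun := f.2

/-- The `q`-sine transform as a linear endomorphism of `L²_q`, given that its defining integrals
converge and that it preserves `L²_q`. -/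
def qSineTransformL2
    (hint : ∀ f : qHalfLine q → 𝕜, MemL2 f → ∀ x : qHalfLine q,
      QIntegrable fun t : qHalfLine q => f t * (qSin q ((x : ℝ) * (t : ℝ)) : 𝕜))
    (hmem : ∀ f : qHalfLine q → 𝕜, MemL2 f → MemL2 (qSineTransform f)) :
    L2 q 𝕜 →ₗ[𝕜] L2 q 𝕜 where
  toFun f := ⟨qSineTransform f.toFun, hmem f.toFun f.memL2⟩
  map_add' f g := L2.toFun_injective
    (qSineTransform_add (hint f.toFun f.memL2) (hint g.toFun g.memL2))
  map_smul' c f := L2.toFun_injective (qSineTransform_smul c f.toFun)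

/-- A linear endomorphism of a normed space that scales norms by `C` and squares to a nonzero
scalar, as a linear homeomorphism. -/
def equivOfSqEqSmul {E : Type*} [NormedAddCommGroup E] [NormedSpace 𝕜 E] (S : E →ₗ[𝕜] E) (c : 𝕜)
    (hc : c ≠ 0) (C : ℝ) (hS : ∀ f, S (S f) = c • f) (hn : ∀ f, ‖S f‖ = C * ‖f‖) : E ≃L[𝕜] E :=
  (LinearEquiv.ofLinearMap S ((1 / c) • S)
    (LinearMap.ext fun f => by simp [hS, smul_smul, hc])
    (LinearMap.ext fun f => by simp [hS, smul_smul, hc])).toContinuousLinearEquivOfBounds C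
      (‖1 / c‖ * C) (fun f => (hn f).le) fun f => by
        change ‖(1 / c) • S f‖ ≤ _
        rw [norm_smul, hn, mul_assoc]

end L2Operator

end QFourier
end

theorem mainTheorem3 {𝕜 : Type*} [RCLike 𝕜] (q : ℝ) [Fact (0 < q ∧ q < 1)]
    (hlog : ∃ k : ℤ, Real.log (1 - q) / Real.log q = (k : ℝ)) :
    (∀ f : QFourier.qHalfLine q → 𝕜, QFourier.MemL2 f →
      (∀ x : QFourier.qHalfLine q, QFourier.QIntegrable fun t : QFourier.qHalfLine q =>
        f t * (QFourier.qSin q ((x : ℝ) * (t : ℝ)) : 𝕜)) ∧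
      QFourier.MemL2 (QFourier.qSineTransform f) ∧
      QFourier.l2Norm (QFourier.qSineTransform f) = q * QFourier.l2Norm f) ∧
    (∃ T : QFourier.L2 q 𝕜 ≃L[𝕜] QFourier.L2 q 𝕜,
      (∀ f : QFourier.L2 q 𝕜, (T f).toFun = QFourier.qSineTransform f.toFun) ∧
      (∀ f : QFourier.L2 q 𝕜,
        (T.symm f).toFun = fun x => (1 / (q : 𝕜) ^ 2) * QFourier.qSineTransform f.toFun x)) := by
  obtain ⟨k, hlogk⟩ := hlog
  obtain ⟨h0, h1⟩ := Fact.out (p := 0 < q ∧ q < 1)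
  have hk := QFourier.one_sub_eq_zpow h0 h1 hlogk
  have hr0 : 0 < √q := Real.sqrt_pos.2 h0
  have hr1 : √q < 1 := by rw [Real.sqrt_lt' one_pos]; simpa using h1
  have hq : q = √q ^ 2 := (Real.sq_sqrt h0.le).symm
  have hint : ∀ f : QFourier.qHalfLine q → 𝕜, QFourier.MemL2 f →
      ∀ x : QFourier.qHalfLine q, QFourier.QIntegrable fun t : QFourier.qHalfLine q =>
        f t * (QFourier.qSin q ((x : ℝ) * (t : ℝ)) : 𝕜) := fun f hf =>
    QFourier.qIntegrable_kernel hr0 hr1 hq hk ((QFourier.memL2_iff_weighted hq f).1 hf)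
  have hmem : ∀ f : QFourier.qHalfLine q → 𝕜, QFourier.MemL2 f →
      QFourier.MemL2 (QFourier.qSineTransform f) := fun f hf =>
    (QFourier.memL2_iff_weighted hq _).2 (QFourier.summable_weighted_qSineTransform hr0 hr1 hq hk
      ((QFourier.memL2_iff_weighted hq f).1 hf)).1
  have hnorm : ∀ f : QFourier.qHalfLine q → 𝕜, QFourier.MemL2 f →
      QFourier.l2Norm (QFourier.qSineTransform f) = q * QFourier.l2Norm f := fun f hf => by
    rw [QFourier.l2Norm_eq_weighted hq, QFourier.l2Norm_eq_weighted hq,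
      (QFourier.summable_weighted_qSineTransform hr0 hr1 hq hk
        ((QFourier.memL2_iff_weighted hq f).1 hf)).2, mul_left_comm,
      Real.sqrt_mul (sq_nonneg q), Real.sqrt_sq h0.le]
  have hinv : ∀ f : QFourier.qHalfLine q → 𝕜, QFourier.MemL2 f →
      QFourier.qSineTransform (QFourier.qSineTransform f) = (q : 𝕜) ^ 2 • f := fun f hf =>
    QFourier.qSineTransform_qSineTransform hr0 hr1 hq hk
      ((QFourier.memL2_iff_weighted hq f).1 hf)
  refine ⟨fun f hf => ⟨hint f hf, hmem f hf, hnorm f hf⟩, ?_⟩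
  let S := QFourier.qSineTransformL2 hint hmem
  have hqk : (q : 𝕜) ^ 2 ≠ 0 := pow_ne_zero _ (RCLike.ofReal_ne_zero.2 h0.ne')
  have hSS : ∀ f, S (S f) = (q : 𝕜) ^ 2 • f := fun f =>
    QFourier.L2.toFun_injective (hinv f.toFun f.memL2)
  have hSn : ∀ f, ‖S f‖ = q * ‖f‖ := fun f => hnorm f.toFun f.memL2
  exact ⟨QFourier.equivOfSqEqSmul S _ hqk q hSS hSn, fun f => rfl, fun f => rfl⟩
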